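/- Write $[m]=\{1,\dots,m\}$. A code is a subset of $2^{[m]}$. For convex open sets $U_1,\dots,U_m$ contained in a convex open set $X\subseteq\mathbb R^d$, the code of $\{U_i\}_{i=1}^m$ in $X$ is $$\mathrm{code}(\{U_i\}_{i=1}^m,X)=\Big\{\sigma\subseteq[m]\ \Big|\ \bigcap_{i\in\sigma}U_i\setminus\bigcup_{j\in[m]\setminus\sigma}U_j\neq\emptyset\Big\},$$ where the empty intersection is $X$. A code $\mathcal C\subseteq 2^{[m]}$ is convex if $\mathcal C=\mathrm{code}(\{U_i\}_{i=1}^m,X)$ for some $d\ge 0$ and some such sets $U_1,\dots,U_m\subseteq X\subseteq\mathbb R^d$. For $n\ge 2$ let $\mathcal C_n\subseteq 2^{[2n+2]}$ be the code consisting of the following codewords: (i) the empty set; (ii) $\sigma\cup\{n+1\}$ for every nonempty proper subset $\sigma$ of $[n]$; (iii) $\{n+1+i\}$ for $1\le i\le n+1$; (iv) $([n]\setminus\{i\})\cup\{n+1\}\cup\{n+1+i\}$ for $1\le i\le n$; (v) $[n]\cup\{n+1\}\cup\{2n+2\}$; (vi) $\{n+2,n+3,\dots,2n+2\}$. **Theorem.**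 For every $n\ge 2$, the code $\mathcal C_n$ is not convex. -/

import Mathlib

namespace CombinatorialCode

/-- The ground set `[m] = {1, …, m}`. -/
def ground (m : ℕ) : Finset ℕ := Finset.Icc 1 m

/-- The atom of `σ ⊆ [m]` for sets `U 1, …, U m` in the ambient set `X`: the points of
`⋂ i ∈ σ, U i` lying in no `U j` with `j ∈ [m] \ σ`, where the empty intersection is `X`. When
every `U i` is contained in `X`, intersecting with `X` matters only for `σ = ∅`.
The values of `U` outside `[m]` play no role when `σ ⊆ [m]`. -/
def atom {E : Type*} (m : ℕ) (U : ℕ → Set E) (X : Set E) (σ : Finset ℕ) : Set E :=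
  (X ∩ ⋂ i ∈ σ, U i) \ ⋃ j ∈ ground m \ σ, U j

/-- The code of `U 1, …, U m` in `X`: all `σ ⊆ [m]` whose atom is nonempty. -/
def codeOf {E : Type*} (m : ℕ) (U : ℕ → Set E) (X : Set E) : Set (Finset ℕ) :=
  {σ | σ ⊆ ground m ∧ (atom m U X σ).Nonempty}

/-- `U 1, …, U m` is a convex realization of the code `C ⊆ 2^[m]` in the ambient space `X ⊆ ℝ^d`:
`X` and `U 1, …, U m` are convex and open, `U i ⊆ X` for all `i`, and the code of the `U i` in `X`
is exactly `C`. -/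
structure IsConvexRealization (m d : ℕ) (U : ℕ → Set (EuclideanSpace ℝ (Fin d)))
    (X : Set (EuclideanSpace ℝ (Fin d))) (C : Set (Finset ℕ)) : Prop where
  isOpen_ambient : IsOpen X
  convex_ambient : Convex ℝ X
  isOpen : ∀ i ∈ ground m, IsOpen (U i)
  convex : ∀ i ∈ ground m, Convex ℝ (U i)
  subset_ambient : ∀ i ∈ ground m, U i ⊆ X
  code_eq : codeOf m U X = C

/-- The code `C ⊆ 2^[m]` is convex: it has a convex realization in some `ℝ^d`. -/
def IsConvexCode (m : ℕ) (C : Set (Finset ℕ)) : Prop :=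
  ∃ (d : ℕ) (U : ℕ → Set (EuclideanSpace ℝ (Fin d))) (X : Set (EuclideanSpace ℝ (Fin d))),
    IsConvexRealization m d U X C

/-- The code `C_n ⊆ 2^[2n+2]` (for `n ≥ 2`). Its codewords are, in this order: the empty set;
`σ ∪ {n+1}` for `σ` a nonempty proper subset of `[n]`; `{n+1+i}` for `1 ≤ i ≤ n+1`;
`([n] \ {i}) ∪ {n+1} ∪ {n+1+i}` for `1 ≤ i ≤ n`; `[n] ∪ {n+1} ∪ {2n+2}`; and
`{n+2, n+3, …, 2n+2}`. -/
def codeC (n : ℕ) : Set (Finset ℕ) :=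
  {c | c = ∅ ∨
    (∃ σ : Finset ℕ, σ.Nonempty ∧ σ ⊂ ground n ∧ c = σ ∪ {n + 1}) ∨
    (∃ i : ℕ, 1 ≤ i ∧ i ≤ n + 1 ∧ c = {n + 1 + i}) ∨
    (∃ i : ℕ, 1 ≤ i ∧ i ≤ n ∧ c = (ground n \ {i}) ∪ {n + 1} ∪ {n + 1 + i}) ∨
    c = ground n ∪ {n + 1} ∪ {2 * n + 2} ∨
    c = Finset.Icc (n + 2) (2 * n + 2)}

theorem codeC_subset (n : ℕ) : ∀ c ∈ codeC n, c ⊆ ground (2 * n + 2) := by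
  intro c hc x hx
  rcases hc with rfl | ⟨σ, -, hσ, rfl⟩ | ⟨i, h1, h2, rfl⟩ | ⟨i, h1, h2, rfl⟩ | rfl | rfl
  · simp at hx
  · have h := hσ.1
    simp only [Finset.mem_union, Finset.mem_singleton] at hx
    rcases hx with hx | hx
    · have := h hx
      simp only [ground, Finset.mem_Icc] at this ⊢
      omega
    · simp only [ground, Finset.mem_Icc]
      omega
  all_goals
    simp only [ground, Finset.mem_union, Finset.mem_singleton, Finset.mem_sdiff,
      Finset.mem_Icc] at hx ⊢
    omega

end CombinatorialCode

/-! Write `V = U (n+1)`, `A = U (2n+2)`, and let the petals be `P i = U (n+1+i)` for `i ≤ n`. The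
code makes `U 1, …, U n` cover `V`, puts their common points in `V` inside `A`, and makes each `P i
∩ A` the same nonempty set `C`, disjoint from `V`. Codewords (iv) give points of `P i ∩ V` lying in
every `U j`, `j ≠ i`. Berge's theorem on the hull `K` of the sets `P i ∩ V` yields `w ∈ K` in all
the `U j`, hence in `A`. By `mem_center_of_mem_convexHull`, `w ∈ C`, although `w ∈ V`. -/

open Set in
/-- The theorem of Berge for open sets: if finitely many open convex sets have convex union and, for each
index, the others share a point of the union, then they all share a point. -/
theorem nonempty_iInter_of_convex_iUnion (n : ℕ) :
    ∀ {E : Type*} [NormedAddCommGroup E] [NormedSpace ℝ E] (U : Fin (n + 1) → Set E)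
      (p : Fin (n + 1) → E), (∀ i, IsOpen (U i)) → (∀ i, Convex ℝ (U i)) →
      Convex ℝ (⋃ i, U i) → (∀ i, p i ∈ ⋃ i, U i) → (∀ i j, j ≠ i → p i ∈ U j) →
      (⋂ i, U i).Nonempty := by
  induction n with
  | zero =>
    intro E _ _ U p _ _ _ hp _
    refine ⟨p 0, mem_iInter.2 fun i => ?_⟩
    obtain ⟨j, hj⟩ := mem_iUnion.1 (hp 0)
    rw [Fin.fin_one_eq_zero i]
    rwa [Fin.fin_one_eq_zero j] at hj
  | succ n ih =>
    intro E _ _ U p ho hc hU hpU hp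
    by_contra hne
    set D : Set E := ⋂ i : Fin (n + 1), U i.castSucc
    have hDo : IsOpen D := isOpen_iInter_of_finite fun i => ho _
    have hDc : Convex ℝ D := convex_iInter fun i => hc _
    have hdisj : Disjoint (U (Fin.last _)) D := by
      rw [Set.disjoint_left]
      intro x hx hxD
      refine hne ⟨x, mem_iInter.2 fun i => ?_⟩
      induction i using Fin.lastCases with
      | last => exact hx
      | cast i => exact mem_iInter.1 hxD i
    obtain ⟨f, s, hfU, hfD⟩ := geometric_hahn_banach_open_open (hc _) (ho _) hDc hDo hdisj
    have hlast : p (Fin.last _) ∈ D :=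
      mem_iInter.2 fun i => hp _ _ (Fin.castSucc_lt_last i).ne
    -- Both endpoints lie in every `U j` with `j ≠ i` and `j` not last, so the crossing points are
    -- the witnesses for the induction inside the hyperplane `f = s`, which misses the last set and
    -- `D`.
    have key : ∀ i : Fin (n + 1), ∃ q ∈ segment ℝ (p i.castSucc) (p (Fin.last _)), f q = s := by
      intro i
      have h1 : f (p i.castSucc) < s := hfU _ (hp _ _ (Fin.castSucc_lt_last i).ne')
      have h2 : s < f (p (Fin.last _)) := hfD _ hlast
      have := (convex_segment (𝕜 := ℝ) (p i.castSucc) (p (Fin.last _))).isPreconnected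
        |>.intermediate_value (left_mem_segment ..) (right_mem_segment ..)
          f.continuous.continuousOn
      exact this ⟨h1.le, h2.le⟩
    choose q hq hfq using key
    -- Translating by `q 0` identifies the hyperplane with the normed space `f.ker`.
    let g : f.ker → E := fun v => q 0 + v
    have hg : Continuous g := by fun_prop
    have hfg : ∀ v, f (g v) = s := fun v => by
      have : f (v : E) = 0 := v.2
      simp [g, hfq, this]
    have hgc : ∀ S : Set E, Convex ℝ S → Convex ℝ (g ⁻¹' S) := fun S hS =>
      (hS.translate_preimage_right (q 0)).linear_preimage f.ker.subtype
    have hmem : ∀ v, (∃ i, g v ∈ U i) → ∃ i : Fin (n + 1), g v ∈ U i.castSucc := by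
      rintro v ⟨i, hi⟩
      induction i using Fin.lastCases with
      | last => exact absurd (hfU _ hi) (by simp [hfg])
      | cast i => exact ⟨i, hi⟩
    have hcov : (⋃ i : Fin (n + 1), g ⁻¹' U i.castSucc) = g ⁻¹' ⋃ i, U i := by
      ext v
      simp only [mem_iUnion, mem_preimage]
      exact ⟨fun ⟨i, hi⟩ => ⟨_, hi⟩, hmem v⟩
    let r : Fin (n + 1) → f.ker := fun i => ⟨q i - q 0, by simp [hfq]⟩
    have hr : ∀ i, g (r i) = q i := fun i => by simp [g, r]
    obtain ⟨v, hv⟩ := ih (fun i => g ⁻¹' U i.castSucc) r (fun i => (ho _).preimage hg)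
      (fun i => hgc _ (hc _)) (hcov ▸ hgc _ hU)
      (fun i => by
        rw [hcov, mem_preimage, hr]
        exact hU.segment_subset (hpU _) (hpU _) (hq i))
      (fun i j hj => by
        rw [mem_preimage, hr]
        exact (hc _).segment_subset (hp _ _ (by simpa using hj))
          (hp _ _ (Fin.castSucc_lt_last j).ne) (hq i))
    have : g v ∈ D := mem_iInter.2 fun i => mem_iInter.1 hv i
    exact absurd (hfD _ this) (by simp [hfg])

/-- Let `A` and the `P i` be open convex sets with `P i ∩ A = C` for all `i`, where `C` is
nonempty. Then every point of `A` in the convex hull of the union of the `P i` lies in `C`. -/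
theorem mem_center_of_mem_convexHull {ι E : Type*} [NormedAddCommGroup E] [NormedSpace ℝ E]
    {P : ι → Set E} {A C : Set E} (hPo : ∀ i, IsOpen (P i)) (hPc : ∀ i, Convex ℝ (P i))
    (hAo : IsOpen A) (hAc : Convex ℝ A) (hC : ∀ i, P i ∩ A = C) (hne : C.Nonempty)
    {w : E} (hwA : w ∈ A) (hw : w ∈ convexHull ℝ (⋃ i, P i)) : w ∈ C := by
  by_contra hwC
  obtain ⟨c, hc⟩ := hne
  obtain ⟨i₀⟩ : Nonempty ι := by
    obtain ⟨y, hy⟩ := convexHull_nonempty_iff.1 ⟨w, hw⟩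
    exact ⟨(Set.mem_iUnion.1 hy).choose⟩
  have hCo : IsOpen C := hC i₀ ▸ (hPo i₀).inter hAo
  have hCc : Convex ℝ C := hC i₀ ▸ (hPc i₀).inter hAc
  have hCA : C ⊆ A := hC i₀ ▸ Set.inter_subset_right
  obtain ⟨q, hqs, hqf⟩ : ∃ q ∈ segment ℝ c w, q ∈ closure C \ C := by
    by_contra! h
    have hs : segment ℝ c w ⊆ C ∪ (closure C)ᶜ := fun x hx =>
      or_iff_not_imp_left.2 fun hxC hxcl => h x hx ⟨hxcl, hxC⟩
    obtain ⟨x, -, hxC, hxcl⟩ := (convex_segment (𝕜 := ℝ) c w).isPreconnected C (closure C)ᶜ hCo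
      isClosed_closure.isOpen_compl hs ⟨c, left_mem_segment .., hc⟩
      ⟨w, right_mem_segment .., (hs (right_mem_segment ..)).resolve_left hwC⟩
    exact hxcl (subset_closure hxC)
  obtain ⟨f, hf⟩ := geometric_hahn_banach_open_point hCc hCo hqf.2
  -- `f c < f q`, so `f` increases along the segment from `c` to `w`.
  have hqw : f q ≤ f w := by
    obtain ⟨a, b, ha, hb, hab, rfl⟩ := hqs
    have h1 := hf c hc
    simp only [map_add, map_smul, smul_eq_mul] at h1 ⊢
    obtain rfl : a = 1 - b := by linarith
    have h2 : 0 < f w - f c := pos_of_mul_pos_right (a := b) (by linarith) hb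
    linarith [mul_nonneg ha h2.le]
  obtain ⟨i, y, hy, hwy⟩ : ∃ i, ∃ y ∈ P i, f w ≤ f y := by
    by_contra! h
    have : convexHull ℝ (⋃ i, P i) ⊆ {x | f x < f w} :=
      convexHull_min (Set.iUnion_subset fun i x hx => h i x hx)
        (convex_halfSpace_lt f.isLinear _)
    exact lt_irrefl (f w) (this hw)
  have hqA : q ∈ A := hAc.segment_subset (hCA hc) hwA hqs
  have hqP : q ∈ closure (P i) := closure_mono (hC i ▸ Set.inter_subset_left) hqf.1
  -- Moving from `q` slightly towards `y` stays in `A` and enters `P i`, hence `C`, where `f < f q`;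
  -- but `f y ≥ f w ≥ f q`.
  have hcont : Filter.Tendsto (AffineMap.lineMap q y : ℝ → E) (nhdsWithin 0 (Set.Ioi 0))
      (nhds q) := by
    have : Continuous (AffineMap.lineMap q y : ℝ → E) := AffineMap.lineMap_continuous
    simpa using (this.tendsto 0).mono_left nhdsWithin_le_nhds
  obtain ⟨t, htA, ht⟩ := ((hcont.eventually (hAo.mem_nhds hqA)).and
    (Ioo_mem_nhdsGT (zero_lt_one' ℝ))).exists
  have hz : AffineMap.lineMap q y t ∈ P i := by
    have := (hPc i).openSegment_closure_interior_subset_interior hqP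
      ((hPo i).interior_eq.symm ▸ hy)
    rw [(hPo i).interior_eq] at this
    exact this (openSegment_eq_image_lineMap ℝ q y ▸ ⟨t, ht, rfl⟩)
  have hlt := hf _ (hC i ▸ ⟨hz, htA⟩ : AffineMap.lineMap q y t ∈ C)
  have : f (AffineMap.lineMap q y t) = f q + t * (f y - f q) := by
    simp [AffineMap.lineMap_apply, add_comm]
  have := mul_nonneg ht.1.le (sub_nonneg.2 (hqw.trans hwy))
  linarith

namespace CombinatorialCode

theorem IsConvexRealization.exists_codeword {m d : ℕ} {U : ℕ → Set (EuclideanSpace ℝ (Fin d))}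
    {X : Set (EuclideanSpace ℝ (Fin d))} {C : Set (Finset ℕ)} (h : IsConvexRealization m d U X C)
    {x : EuclideanSpace ℝ (Fin d)} (hx : x ∈ X) :
    ∃ c ∈ C, ∀ i ∈ ground m, x ∈ U i ↔ i ∈ c := by
  classical
  refine ⟨(ground m).filter fun i => x ∈ U i, ?_, fun i hi => by simp [hi]⟩
  rw [← h.code_eq]
  refine ⟨Finset.filter_subset _ _, x, ⟨hx, ?_⟩, ?_⟩
  · simp
  · simp only [Set.mem_iUnion, Finset.mem_sdiff, Finset.mem_filter, not_exists]
    exact fun i hi hxi => hi.2 ⟨hi.1, hxi⟩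

theorem IsConvexRealization.exists_point {m d : ℕ} {U : ℕ → Set (EuclideanSpace ℝ (Fin d))}
    {X : Set (EuclideanSpace ℝ (Fin d))} {C : Set (Finset ℕ)} (h : IsConvexRealization m d U X C)
    {c : Finset ℕ} (hc : c ∈ C) : ∃ x ∈ X, ∀ i ∈ c, x ∈ U i := by
  rw [← h.code_eq] at hc
  obtain ⟨-, x, ⟨hx, hxc⟩, -⟩ := hc
  exact ⟨x, hx, by simpa using hxc⟩

section CodeC

variable {n : ℕ} {c : Finset ℕ}

/-- This gives the cover of `V`. For codewords (iv) it needs `n ≥ 2`, so that `[n] \ {i}` is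
nonempty. -/
theorem exists_mem_of_mem_codeC (hn : 2 ≤ n) (hc : c ∈ codeC n) (h : n + 1 ∈ c) :
    ∃ i, 1 ≤ i ∧ i ≤ n ∧ i ∈ c := by
  rcases hc with rfl | ⟨σ, ⟨a, ha⟩, hσ, rfl⟩ | ⟨i, h1, h2, rfl⟩ | ⟨i, h1, h2, rfl⟩ | rfl | rfl
  · simp at h
  · have := hσ.1 ha
    simp only [ground, Finset.mem_Icc] at this
    exact ⟨a, this.1, this.2, by simp [ha]⟩
  · simp at h
    omega
  · obtain rfl | hi := eq_or_ne i 1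
    · exact ⟨2, by omega, hn, by simp [ground, hn]⟩
    · exact ⟨1, le_rfl, by omega, by simp [ground]; omega⟩
  · exact ⟨1, le_rfl, by omega, by simp [ground]; omega⟩
  · simp at h

theorem last_mem_of_mem_codeC (hn : 2 ≤ n) (hc : c ∈ codeC n) (h : ∀ i, 1 ≤ i → i ≤ n → i ∈ c) :
    2 * n + 2 ∈ c := by
  rcases hc with rfl | ⟨σ, -, hσ, rfl⟩ | ⟨i, h1, h2, rfl⟩ | ⟨i, h1, h2, rfl⟩ | rfl | rfl
  · simpa using h 1 le_rfl (by omega)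
  · refine absurd (fun i hi => ?_) hσ.2
    simp only [ground, Finset.mem_Icc] at hi
    have := h i hi.1 hi.2
    simp only [Finset.mem_union, Finset.mem_singleton] at this
    exact this.resolve_right (by omega)
  · have := h 1 le_rfl (by omega)
    simp at this
    omega
  · have := h i h1 h2
    simp at this
    omega
  · simp
  · simp
    omega

theorem eq_of_mem_codeC_of_mem_petals (hc : c ∈ codeC n) {i : ℕ} (h1 : 1 ≤ i) (hi : i ≤ n)
    (h : n + 1 + i ∈ c) (hl : 2 * n + 2 ∈ c) : c = Finset.Icc (n + 2) (2 * n + 2) := by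
  rcases hc with rfl | ⟨σ, -, hσ, rfl⟩ | ⟨j, h1, h2, rfl⟩ | ⟨j, h1, h2, rfl⟩ | rfl | rfl
  · simp at h
  · have := @hσ.1 (n + 1 + i)
    simp only [ground, Finset.mem_Icc, Finset.mem_union, Finset.mem_singleton] at this h
    have := this (h.resolve_right (by omega))
    omega
  · simp only [Finset.mem_singleton] at h hl
    omega
  · simp [ground] at h hl
    omega
  · simp [ground] at h hl
    omega
  · rfl

end CodeC

end CombinatorialCode

open CombinatorialCode in
theorem mainTheorem3 (n : ℕ) (hn : 2 ≤ n) :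
    ¬ CombinatorialCode.IsConvexCode (2 * n + 2) (CombinatorialCode.codeC n) := by
  rintro ⟨d, U, X, h⟩
  obtain ⟨k, rfl⟩ : ∃ k, n = k + 1 := ⟨n - 1, by omega⟩
  set n := k + 1 with hnk
  have hg : ∀ {i}, 1 ≤ i → i ≤ 2 * n + 2 → i ∈ ground (2 * n + 2) := fun h1 h2 =>
    Finset.mem_Icc.2 ⟨h1, h2⟩
  have hgP (i : Fin n) : n + 1 + (i + 1) ∈ ground (2 * n + 2) := hg (by omega) (by omega)
  have hgU (i : Fin n) : (i + 1 : ℕ) ∈ ground (2 * n + 2) := hg (by omega) (by omega)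
  have hgV : n + 1 ∈ ground (2 * n + 2) := hg (by omega) (by omega)
  have hgA : 2 * n + 2 ∈ ground (2 * n + 2) := hg (by omega) (by omega)
  let P : Fin n → Set (EuclideanSpace ℝ (Fin d)) := fun i => U (n + 1 + (i + 1))
  let C : Set (EuclideanSpace ℝ (Fin d)) := {x ∈ X | ∀ i ∈ Finset.Icc (n + 2) (2 * n + 2), x ∈ U i}
  have hPC (i : Fin n) : P i ∩ U (2 * n + 2) = C := by
    ext x
    refine ⟨fun ⟨hxP, hxA⟩ => ?_, fun hx => ⟨hx.2 _ (by simp; omega), hx.2 _ (by simp; omega)⟩⟩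
    have hx := h.subset_ambient _ hgA hxA
    obtain ⟨c, hc, hxc⟩ := h.exists_codeword hx
    obtain rfl := eq_of_mem_codeC_of_mem_petals hc (by omega) (by omega)
      ((hxc _ (hgP i)).1 hxP) ((hxc _ hgA).1 hxA)
    exact ⟨hx, fun j hj => (hxc j (codeC_subset n _ hc hj)).2 hj⟩
  have hCne : C.Nonempty := h.exists_point (by simp [codeC])
  have hCV : ∀ x ∈ C, x ∉ U (n + 1) := by
    intro x hx hxV
    obtain ⟨c, hc, hxc⟩ := h.exists_codeword hx.1
    have h0 : (1 : ℕ) ≤ n := by omega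
    obtain rfl := eq_of_mem_codeC_of_mem_petals hc le_rfl h0
      ((hxc _ (hg (by omega) (by omega))).1 (hx.2 _ (by simp; omega)))
      ((hxc _ hgA).1 (hx.2 _ (by simp; omega)))
    simpa using (hxc _ hgV).1 hxV
  have hpt (i : Fin n) : ∃ x ∈ U (n + 1), x ∈ P i ∧ ∀ j : Fin n, j ≠ i → x ∈ U (j + 1) := by
    obtain ⟨x, -, hx⟩ := h.exists_point
      (c := (ground n \ {(i : ℕ) + 1}) ∪ {n + 1} ∪ {n + 1 + ((i : ℕ) + 1)})
      (Or.inr <| Or.inr <| Or.inr <| Or.inl ⟨i + 1, by omega, by omega, rfl⟩)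
    refine ⟨x, hx _ (by simp), hx _ (by simp), fun j hj => hx _ ?_⟩
    have : (j : ℕ) ≠ i := fun h => hj (Fin.ext h)
    simp [ground, this]
  choose p hpV hpP hpU using hpt
  -- Intersecting with `V` before taking hulls keeps `K` inside `V`, where the `U j` cover.
  set K : Set (EuclideanSpace ℝ (Fin d)) := convexHull ℝ (⋃ i, P i ∩ U (n + 1))
  have hKo : IsOpen K :=
    (isOpen_iUnion fun i => (h.isOpen _ (hgP i)).inter (h.isOpen _ hgV)).convexHull
  have hKc : Convex ℝ K := convex_convexHull _ _
  have hKV : K ⊆ U (n + 1) :=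
    convexHull_min (Set.iUnion_subset fun i => Set.inter_subset_right) (h.convex _ hgV)
  have hpK (i : Fin n) : p i ∈ K :=
    subset_convexHull _ _ (Set.mem_iUnion.2 ⟨i, hpP i, hpV i⟩)
  have hcov : (⋃ i : Fin n, U (i + 1) ∩ K) = K := by
    refine (Set.iUnion_subset fun i => Set.inter_subset_right).antisymm fun x hx => ?_
    obtain ⟨c, hc, hxc⟩ := h.exists_codeword (h.subset_ambient _ hgV (hKV hx))
    obtain ⟨i, h1, h2, hi⟩ := exists_mem_of_mem_codeC hn hc ((hxc _ hgV).1 (hKV hx))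
    refine Set.mem_iUnion.2 ⟨⟨i - 1, by omega⟩, ?_, hx⟩
    simpa [Nat.sub_add_cancel h1] using (hxc i (hg h1 (by omega))).2 hi
  obtain ⟨w, hw⟩ := nonempty_iInter_of_convex_iUnion k (fun i : Fin n => U (i + 1) ∩ K) p
    (fun i => (h.isOpen _ (hgU i)).inter hKo) (fun i => (h.convex _ (hgU i)).inter hKc)
    (hcov.symm ▸ hKc) (fun i => hcov.symm ▸ hpK i) (fun i j hj => ⟨hpU i j hj, hpK i⟩)
  rw [Set.mem_iInter] at hw
  have hwK : w ∈ K := (hw 0).2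
  have hwA : w ∈ U (2 * n + 2) := by
    obtain ⟨c, hc, hxc⟩ := h.exists_codeword (h.subset_ambient _ hgV (hKV hwK))
    refine (hxc _ hgA).2 (last_mem_of_mem_codeC hn hc fun i h1 h2 => ?_)
    refine (hxc i (hg h1 (by omega))).1 ?_
    simpa [Nat.sub_add_cancel h1] using (hw ⟨i - 1, by omega⟩).1
  exact hCV w (mem_center_of_mem_convexHull (fun i => h.isOpen _ (hgP i))
    (fun i => h.convex _ (hgP i)) (h.isOpen _ hgA) (h.convex _ hgA) hPC hCne hwA
    (convexHull_mono (Set.iUnion_mono fun i => Set.inter_subset_left) hwK)) (hKV hwK)
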